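/- A \emph{cLD election} consists of a finite directed graph $G=(N,E)$ (the vertices are voters; an edge $(i,j)$ means that $i$ approves $j$ as representative) and two functions $v,d:N\to\mathbb N$ giving each voter's voting cost and delegating cost. A \emph{solution} is a pair $(C,D)$ where $C\subseteq N$ (the casting voters) and $D\subseteq E$ consists of exactly one outgoing edge for each voter in $N\setminus C$. \textsc{Delegate Reachability} asks, given a cLD election and a positive integer $\beta$, whether there is a solution $(C,D)$ such that $\sum_{i\in C}v(i)+\sum_{i\in N\setminus C}d(i)\le\beta$ and from every $i\in N\setminus C$ there is a directed path to a vertex of $C$ using only edges in $D$. Allowing for $\alpha$ abstainers, the question becomes whether there is a set $A\subseteq N$ with $|A|\le\alpha$ such that the election obtained by deleting the voters in $A$ (with all edges incident to them, and their costs) is a positive instance of \textsc{Delegate Reachability} with the same budget $\beta$. \textbf{Proposition.} For every constant $\alpha\in\mathbb N$, \textsc{Delegate Reachability} allowing for $\alpha$ abstainers is solvable in polynomial time: there is an algorithm that decides every instance $(G,v,d,\beta)$ in time polynomial in the size of the instance, where the costs and $\beta$ are written in binary. (Time is counted on a random access machine with logarithmic cost; the polynomial may depend on $\alpha$.) -/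

import Mathlib

/-! ### Elections -/

/-- A cLD election: a delegation graph on the set `N` of voters (an edge from `i` to `j` says that
`i` approves `j` as immediate representative), a voting cost `v i` and a delegating cost `d i` for
each voter `i`. -/
structure CLDElection (N : Type*) where
  graph : Digraph N
  v : N → ℕ
  d : N → ℕ

namespace CLDElection

/-- `(C, D)` is a solution: `C` is the set of casting voters, and `D` is a set of edges of the
delegation graph which consists of exactly one outgoing edge for each voter not in `C`. -/
def IsSolution {N : Type*} (G : CLDElection N) (C : Finset N) (D : Digraph N) : Prop :=
  D ≤ G.graph ∧ (∀ i, i ∉ C → ∃! j, D.Adj i j) ∧ (∀ i, i ∈ C → ∀ j, ¬ D.Adj i j)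

/-- The cost of a solution with casting voters `C`. -/
def cost {N : Type*} [Fintype N] [DecidableEq N] (G : CLDElection N) (C : Finset N) : ℕ :=
  (∑ i ∈ C, G.v i) + ∑ i ∈ Cᶜ, G.d i

/-- Every delegating voter has a directed path, using only edges of `D`, to a casting voter. -/
def Reaches {N : Type*} (C : Finset N) (D : Digraph N) : Prop :=
  ∀ i, i ∉ C → ∃ j ∈ C, Relation.ReflTransGen D.Adj i j

/-- The question of the problem Delegate Reachability, for the budget `β`. -/
def DelegateReachability {N : Type*} [Fintype N] [DecidableEq N] (G : CLDElection N) (β : ℕ) :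
    Prop :=
  ∃ (C : Finset N) (D : Digraph N), G.IsSolution C D ∧ G.cost C ≤ β ∧ Reaches C D

/-- The election that remains when the voters in `A` are excluded, together with all edges from or
to them. -/
def exclude {N : Type*} (G : CLDElection N) (A : Finset N) : CLDElection {i : N // i ∉ A} where
  graph := { Adj := fun i j => G.graph.Adj i.1 j.1 }
  v := fun i => G.v i.1
  d := fun i => G.d i.1

/-- The question of Delegate Reachability when `α` abstainers are allowed: can one exclude at most
`α` voters such that the remaining election is a positive instance? -/
def DelegateReachabilityWithAbstainers {N : Type*} [Fintype N] [DecidableEq N] (α : ℕ)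
    (G : CLDElection N) (β : ℕ) : Prop :=
  ∃ A : Finset N, A.card ≤ α ∧ (G.exclude A).DelegateReachability β

end CLDElection

/-- An instance of Delegate Reachability: an election on the voters `0, …, n - 1` and a positive
budget. -/
structure DRInstance where
  n : ℕ
  election : CLDElection (Fin n)
  budget : ℕ
  budget_pos : 0 < budget

open Classical in
/-- The instance as a word of natural numbers: the number of voters, the budget, the voting costs,
the delegating costs, and the rows of the 0-1 adjacency matrix of the delegation graph. -/
noncomputable def DRInstance.encode (I : DRInstance) : List ℕ :=
  I.n :: I.budget :: (List.ofFn I.election.v ++ List.ofFn I.election.d ++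
    List.ofFn fun k : Fin (I.n * I.n) =>
      if I.election.graph.Adj k.divNat k.modNat then 1 else 0)

/-! ### Random access machines with logarithmic cost

The input is a read-only word of natural numbers. The memory consists of arrays of natural numbers,
initially zero; a program names finitely many of them. (Cell `0` of an array serves as an ordinary
register; an index may be the value of any expression, so addressing is indirect.) Numbers are
written in binary: every evaluation of an operation is charged the bit length of its result, so that
every operand, address and stored value is paid for bit by bit. -/

namespace RAM

/-- Expressions of the programming language. -/
inductive Expr : Type
  | const (c : ℕ) : Expr
  | inputLength : Expr
  | input (e : Expr) : Expr
  | get (a : ℕ) (e : Expr) : Expr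
  | add (e₁ e₂ : Expr) : Expr
  | sub (e₁ e₂ : Expr) : Expr
  | mul (e₁ e₂ : Expr) : Expr

/-- The contents of the memory: `s a i` is the content of cell `i` of array `a`. -/
abbrev Store : Type := ℕ → ℕ → ℕ

namespace Expr

/-- The value of an expression on the input word `w` with memory `s`. Input positions beyond the
end of `w` read as `0`, and subtraction is truncated at `0`. -/
def eval (w : List ℕ) (s : Store) : Expr → ℕ
  | const c => c
  | inputLength => w.length
  | input e => w.getD (e.eval w s) 0
  | get a e => s a (e.eval w s)
  | add e₁ e₂ => e₁.eval w s + e₂.eval w s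
  | sub e₁ e₂ => e₁.eval w s - e₂.eval w s
  | mul e₁ e₂ => e₁.eval w s * e₂.eval w s

/-- The time to evaluate an expression: each operation costs `1` plus the bit length of its
result. -/
def time (w : List ℕ) (s : Store) : Expr → ℕ
  | const c => 1 + Nat.size c
  | inputLength => 1 + Nat.size w.length
  | input e => e.time w s + 1 + Nat.size ((input e).eval w s)
  | get a e => e.time w s + 1 + Nat.size ((get a e).eval w s)
  | add e₁ e₂ => e₁.time w s + e₂.time w s + 1 + Nat.size ((add e₁ e₂).eval w s)
  | sub e₁ e₂ => e₁.time w s + e₂.time w s + 1 + Nat.size ((sub e₁ e₂).eval w s)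
  | mul e₁ e₂ => e₁.time w s + e₂.time w s + 1 + Nat.size ((mul e₁ e₂).eval w s)

end Expr

/-- Programs. `set a e₁ e₂` stores the value of `e₂` in cell `e₁` of array `a`; a test succeeds if
the value of the expression is not `0`. -/
inductive Program : Type
  | skip : Program
  | set (a : ℕ) (e₁ e₂ : Expr) : Program
  | seq (p q : Program) : Program
  | ite (e : Expr) (p q : Program) : Program
  | loop (e : Expr) (p : Program) : Program

/-- `Exec w p s t s'`: on the input word `w`, the program `p` started with memory `s` halts after
time `t` with memory `s'`. -/
inductive Exec (w : List ℕ) : Program → Store → ℕ → Store → Prop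
  | skip (s : Store) : Exec w .skip s 1 s
  | set (a : ℕ) (e₁ e₂ : Expr) (s : Store) :
      Exec w (.set a e₁ e₂) s (e₁.time w s + e₂.time w s + 1)
        (Function.update s a (Function.update (s a) (e₁.eval w s) (e₂.eval w s)))
  | seq {p q : Program} {s s' s'' : Store} {t t' : ℕ} :
      Exec w p s t s' → Exec w q s' t' s'' → Exec w (.seq p q) s (t + t') s''
  | ite_true {e : Expr} {p q : Program} {s s' : Store} {t : ℕ} :
      e.eval w s ≠ 0 → Exec w p s t s' → Exec w (.ite e p q) s (e.time w s + 1 + t) s'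
  | ite_false {e : Expr} {p q : Program} {s s' : Store} {t : ℕ} :
      e.eval w s = 0 → Exec w q s t s' → Exec w (.ite e p q) s (e.time w s + 1 + t) s'
  | loop_true {e : Expr} {p : Program} {s s' s'' : Store} {t t' : ℕ} :
      e.eval w s ≠ 0 → Exec w p s t s' → Exec w (.loop e p) s' t' s'' →
        Exec w (.loop e p) s (e.time w s + 1 + t + t') s''
  | loop_false {e : Expr} {p : Program} {s : Store} :
      e.eval w s = 0 → Exec w (.loop e p) s (e.time w s + 1) s

/-- The size of a word of natural numbers: the total bit length of its entries, plus one for each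
entry. -/
def inputSize (w : List ℕ) : ℕ := (w.map fun x => Nat.size x + 1).sum

/-- The decision problem with the instances `ι`, encoded as words of natural numbers by `encode`,
and with the positive instances `P`, is solvable in polynomial time: some program halts on every
instance within a time that is polynomial in the size of the encoded instance, and its answer, in
cell `0` of array `0`, is nonzero exactly on the positive instances. -/
def PolyTimeDecidable {ι : Type} (encode : ι → List ℕ) (P : ι → Prop) : Prop :=
  ∃ (p : Program) (f : Polynomial ℕ), ∀ x : ι, ∃ (t : ℕ) (s : Store),
    Exec (encode x) p (fun _ _ => 0) t s ∧ t ≤ f.eval (inputSize (encode x)) ∧ (s 0 0 ≠ 0 ↔ P x)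

end RAM

/-! A set `C` of casting voters admits suitable delegations exactly when every voter can reach `C`
in the delegation graph (`exists_isSolution_reaches_iff`): let everyone delegate along a shortest
path. For finite graphs this means that `C` meets every sink strongly connected component. Call the
truncated difference `v i - d i` the surcharge of `i`. Every solution costs at least the sum of the
`min (v i) (d i)` plus the surcharges of `C`. Casting all voters with surcharge zero is free, and
each sink component without such a voter forces one voter, at best one of least surcharge. Hence the
greedy set `GreedyCast` is optimal, and the question becomes one inequality
(`delegateReachability_iff`) that needs only reachability and comparisons. For constant `α`, all
sets of at most `α` excluded voters can be tried by `α` nested loops (`Prog.abstain`,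
`Prog.abstain_sem`).

The running time is obtained compositionally. The algorithm is written in a language whose loops all
run `n` times. Products occur in tests and addresses but are never stored, so an assignment
lengthens the stored numbers by a constant number of bits only. Time and growth of bit length are
then polynomial by induction on the program (`Prog.WF.exists_runs`), and correctness is a statement
about the denotational semantics `Prog.sem`. -/

namespace CLDElection

/-! ### Optimality of the greedy solution. -/

section Greedy

variable {N : Type*} (G : CLDElection N)

/-- A set of casting voters extends to a solution in which every delegating voter reaches it if and
only if it can be reached from everywhere in the delegation graph. -/
theorem exists_isSolution_reaches_iff (C : Finset N) :
    (∃ D, G.IsSolution C D ∧ Reaches C D) ↔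
      ∀ i, ∃ j ∈ C, Relation.ReflTransGen G.graph.Adj i j := by
  classical
  constructor
  · rintro ⟨D, hD, hr⟩ i
    by_cases hi : i ∈ C
    · exact ⟨i, hi, .refl⟩
    · obtain ⟨j, hj, h⟩ := hr i hi
      exact ⟨j, hj, h.lift id fun a b hab => hD.1 hab⟩
  · intro h
    have hrank : ∃ r : N → ℕ, ∀ i, i ∉ C → ∃ j, G.graph.Adj i j ∧ r j < r i := by
      -- `P m i` holds if some walk with `m` edges leads from `i` into `C`; the rank is the least
      -- such `m`.
      let P : ℕ → N → Prop := fun m => Nat.rec (fun i => i ∈ C)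
        (fun _ Q i => ∃ j, G.graph.Adj i j ∧ Q j) m
      have hP : ∀ i, ∃ m, P m i := by
        intro i
        obtain ⟨j, hj, hij⟩ := h i
        induction hij using Relation.ReflTransGen.head_induction_on with
        | refl => exact ⟨0, hj⟩
        | head hab _ ih =>
          obtain ⟨m, hm⟩ := ih
          exact ⟨m + 1, _, hab, hm⟩
      refine ⟨fun i => sInf {m | P m i}, fun i hi => ?_⟩
      have hs : P (sInf {m | P m i}) i := Nat.sInf_mem (hP i)
      change ∃ j, G.graph.Adj i j ∧ sInf {m | P m j} < sInf {m | P m i}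
      generalize sInf {m | P m i} = m at hs ⊢
      cases m with
      | zero => exact absurd hs hi
      | succ m =>
        obtain ⟨j, hj, hmj⟩ := hs
        exact ⟨j, hj, Nat.lt_succ_of_le (Nat.sInf_le hmj)⟩
    obtain ⟨r, hr⟩ := hrank
    choose! f hf hlt using hr
    refine ⟨⟨fun i j => i ∉ C ∧ j = f i⟩, ⟨?_, ?_, ?_⟩, ?_⟩
    · rintro i j ⟨hi, rfl⟩
      exact hf i hi
    · exact fun i hi => ⟨f i, ⟨hi, rfl⟩, fun j hj => hj.2⟩
    · exact fun i hi j hj => hj.1 hi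
    · intro i
      induction hm : r i using Nat.strong_induction_on generalizing i with
      | _ m ih =>
        intro hi
        have hstep : i ∉ C ∧ f i = f i := ⟨hi, rfl⟩
        by_cases hfi : f i ∈ C
        · exact ⟨f i, hfi, .single hstep⟩
        · obtain ⟨j, hj, hp⟩ := ih _ (hm ▸ hlt i hi) (f i) rfl hfi
          exact ⟨j, hj, .head hstep hp⟩

/-- The voters that cast their vote in a cheapest solution: those for whom voting is not dearer than
delegating, and the voters of every sink component for whom the surcharge for voting is minimal,
where ties are broken by the injection `e`. -/
def GreedyCast (e : N → ℕ) (i : N) : Prop :=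
  G.v i - G.d i = 0 ∨ ∀ j, Relation.ReflTransGen G.graph.Adj i j →
    Relation.ReflTransGen G.graph.Adj j i ∧
      (G.v i - G.d i < G.v j - G.d j ∨ G.v i - G.d i = G.v j - G.d j ∧ e i ≤ e j)

variable [Fintype N]

/-- Every voter reaches a sink component, and the voter of that component which is least by
surcharge and then by `e` is greedy. -/
theorem exists_reachable_greedyCast (e : N → ℕ) (i : N) :
    ∃ j, G.GreedyCast e j ∧ Relation.ReflTransGen G.graph.Adj i j := by
  classical
  let R : N → Finset N := fun j => {k | Relation.ReflTransGen G.graph.Adj j k}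
  have hR : ∀ j k, k ∈ R j ↔ Relation.ReflTransGen G.graph.Adj j k := fun j k => by simp [R]
  -- A vertex whose set of reachable vertices is smallest lies in a sink component: anything it
  -- reaches has the same reachable set.
  obtain ⟨j, hj, hmin⟩ := Finset.exists_min_image (R i) (fun j => (R j).card) ⟨i, (hR i i).2 .refl⟩
  have hback : ∀ k, Relation.ReflTransGen G.graph.Adj j k →
      Relation.ReflTransGen G.graph.Adj k j := by
    intro k hk
    have hsub : R k ⊆ R j := fun l hl => (hR j l).2 (hk.trans ((hR k l).1 hl))
    have heq := Finset.eq_of_subset_of_card_le hsub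
      (hmin k ((hR i k).2 (((hR i j).1 hj).trans hk)))
    exact (hR k j).1 (heq ▸ (hR j j).2 .refl)
  obtain ⟨k, hk, hkmin⟩ := Finset.exists_min_image (R j)
    (fun k => toLex (G.v k - G.d k, e k)) ⟨j, (hR j j).2 .refl⟩
  have hjk := (hR j k).1 hk
  refine ⟨k, Or.inr fun l hl => ⟨?_, ?_⟩, ((hR i j).1 hj).trans hjk⟩
  · exact (hback l (hjk.trans hl)).trans hjk
  · exact (Prod.Lex.toLex_le_toLex).1 (hkmin l ((hR j l).2 (hjk.trans hl)))

open Classical in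
/-- An election is a positive instance exactly if the greedy solution stays within the budget. -/
theorem delegateReachability_iff [DecidableEq N] (e : N → ℕ) (he : Function.Injective e) (β : ℕ) :
    G.DelegateReachability β ↔
      ∑ i, (if G.GreedyCast e i then G.v i else G.d i) ≤ β := by
  have hcost : ∀ C : Finset N, G.cost C = ∑ i, (if i ∈ C then G.v i else G.d i) := by
    intro C
    rw [cost, ← Finset.sum_add_sum_compl C]
    congr 1
    · exact Finset.sum_congr rfl fun i hi => by rw [if_pos hi]
    · exact Finset.sum_congr rfl fun i hi => by rw [if_neg (Finset.mem_compl.1 hi)]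
  constructor
  · rintro ⟨C, D, hD, hC, hr⟩
    have hreach := (G.exists_isSolution_reaches_iff C).1 ⟨D, hD, hr⟩
    choose f hfC hf using hreach
    refine le_trans ?_ (hcost C ▸ hC)
    -- For the greedy set, cost is exactly the minimum plus the surcharges, since a voter who
    -- delegates there has positive surcharge. For an arbitrary `C` only the inequality `h2` holds.
    have h1 : ∀ i, (if G.GreedyCast e i then G.v i else G.d i)
        = min (G.v i) (G.d i) + if G.GreedyCast e i then G.v i - G.d i else 0 := by
      intro i
      split_ifs with h
      · omega
      · have : G.v i - G.d i ≠ 0 := fun h0 => h (Or.inl h0)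
        omega
    have h2 : ∀ i, min (G.v i) (G.d i) + (if i ∈ C then G.v i - G.d i else 0)
        ≤ (if i ∈ C then G.v i else G.d i) := by
      intro i
      split_ifs <;> omega
    refine le_trans ?_ (Finset.sum_le_sum fun i _ => h2 i)
    simp_rw [h1]
    rw [Finset.sum_add_distrib, Finset.sum_add_distrib]
    refine Nat.add_le_add_left ?_ _
    rw [← Finset.sum_filter, ← Finset.sum_filter]
    -- Only greedy voters with positive surcharge matter. They are mapped into `C` by `f`, which
    -- stays in the sink component and does not lower the surcharge.
    let S : Finset N := {i | G.GreedyCast e i ∧ G.v i - G.d i ≠ 0}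
    have hS : ∀ i ∈ S, ∀ j, Relation.ReflTransGen G.graph.Adj i j →
        Relation.ReflTransGen G.graph.Adj j i ∧
        (G.v i - G.d i < G.v j - G.d j ∨ G.v i - G.d i = G.v j - G.d j ∧ e i ≤ e j) := by
      intro i hi
      obtain ⟨h, h0⟩ := (Finset.mem_filter.1 hi).2
      exact h.resolve_left h0
    -- If `f i = f j`, then `i` and `j` lie in the same sink component; both are minimal there, so
    -- the tie-breaker `e` identifies them.
    have hinj : Set.InjOn f S := by
      intro i hi j hj hij
      have hi' := hS i hi
      have hj' := hS j hj
      have h3 := (hi' j ((hf i).trans (hij ▸ (hj' _ (hf j)).1))).2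
      have h4 := (hj' i ((hf j).trans (hij ▸ (hi' _ (hf i)).1))).2
      apply he
      omega
    calc ∑ i with G.GreedyCast e i, (G.v i - G.d i)
        = ∑ i ∈ S, (G.v i - G.d i) := by
          refine (Finset.sum_subset ?_ ?_).symm
          · intro i hi
            simp only [S, Finset.mem_filter] at hi ⊢
            exact ⟨hi.1, hi.2.1⟩
          · intro i hi hiS
            by_contra h0
            exact hiS (by simp only [S, Finset.mem_filter] at hi ⊢; exact ⟨hi.1, hi.2, h0⟩)
      _ ≤ ∑ i ∈ S, (G.v (f i) - G.d (f i)) := by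
          refine Finset.sum_le_sum fun i hi => ?_
          have := (hS i hi _ (hf i)).2
          omega
      _ = ∑ j ∈ S.image f, (G.v j - G.d j) :=
          (Finset.sum_image (f := fun j => G.v j - G.d j) hinj).symm
      _ ≤ ∑ i with i ∈ C, (G.v i - G.d i) := by
          refine Finset.sum_le_sum_of_subset fun j hj => ?_
          obtain ⟨i, -, rfl⟩ := Finset.mem_image.1 hj
          simpa using hfC i
  · intro h
    obtain ⟨D, hD, hr⟩ := (G.exists_isSolution_reaches_iff
      ({i | G.GreedyCast e i} : Finset N)).2 fun i => by
        obtain ⟨j, hj, hij⟩ := G.exists_reachable_greedyCast e i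
        exact ⟨j, by simpa using hj, hij⟩
    refine ⟨_, D, hD, ?_, hr⟩
    rw [hcost]
    simpa using h

end Greedy

end CLDElection

/-! ### Bit lengths and running times of expressions and programs. -/

namespace RAM

/-- All entries of the word, its length, and all cells of the memory have bit length at most
`L`. -/
def Sized (L : ℕ) (w : List ℕ) (s : Store) : Prop :=
  (∀ i, Nat.size (w.getD i 0) ≤ L) ∧ Nat.size w.length ≤ L ∧ ∀ a i, Nat.size (s a i) ≤ L

theorem Sized.mono {L L' : ℕ} {w : List ℕ} {s : Store} (h : Sized L w s) (hL : L ≤ L') :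
    Sized L' w s :=
  ⟨fun i => (h.1 i).trans hL, h.2.1.trans hL, fun a i => (h.2.2 a i).trans hL⟩

theorem size_add_le {x y A : ℕ} (hx : Nat.size x ≤ A) (hy : Nat.size y ≤ A) :
    Nat.size (x + y) ≤ A + 1 := by
  rw [Nat.size_le] at *
  rw [pow_succ]
  omega

theorem size_mul_le {x y A B : ℕ} (hx : Nat.size x ≤ A) (hy : Nat.size y ≤ B) :
    Nat.size (x * y) ≤ A + B := by
  rw [Nat.size_le] at *
  rw [pow_add]
  exact Nat.mul_lt_mul'' hx hy

theorem size_sub_le {x y A : ℕ} (hx : Nat.size x ≤ A) : Nat.size (x - y) ≤ A :=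
  (Nat.size_le_size (Nat.sub_le x y)).trans hx

namespace Expr

/-- The value of the expression is not a product, so that it is only a constant number of bits
longer than the values in the memory. -/
def Storable : Expr → Prop
  | add e₁ e₂ => e₁.Storable ∧ e₂.Storable
  | sub e₁ e₂ => e₁.Storable ∧ e₂.Storable
  | mul _ _ => False
  | _ => True

/-- The additive form of the bound is essential: a stored product could double the bit length in
each round of a loop. -/
theorem Storable.exists_size_eval_le {e : Expr} (he : e.Storable) :
    ∃ c, ∀ L w s, Sized L w s → Nat.size (e.eval w s) ≤ L + c := by
  induction e with
  | const c => exact ⟨Nat.size c, fun L w s _ => by simp [eval]⟩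
  | inputLength => exact ⟨0, fun L w s h => h.2.1⟩
  | input e => exact ⟨0, fun L w s h => h.1 _⟩
  | get a e => exact ⟨0, fun L w s h => h.2.2 _ _⟩
  | add e₁ e₂ h₁ h₂ =>
    obtain ⟨c₁, h₁⟩ := h₁ he.1
    obtain ⟨c₂, h₂⟩ := h₂ he.2
    refine ⟨c₁ + c₂ + 1, fun L w s h => ?_⟩
    have := size_add_le (A := L + (c₁ + c₂)) ((h₁ L w s h).trans (by omega))
      ((h₂ L w s h).trans (by omega))
    simpa [eval, add_assoc] using this
  | sub e₁ e₂ h₁ h₂ =>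
    obtain ⟨c₁, h₁⟩ := h₁ he.1
    exact ⟨c₁, fun L w s h => size_sub_le (h₁ L w s h)⟩
  | mul => exact he.elim

/-- A multiplicative bound suffices for evaluation time and for values that are not stored, so
products are allowed here. -/
theorem exists_time_le (e : Expr) :
    ∃ c, ∀ L w s, Sized L w s →
      Nat.size (e.eval w s) ≤ c * (L + 1) ∧ e.time w s ≤ c * (L + 1) := by
  induction e with
  | const c =>
    refine ⟨1 + Nat.size c, fun L w s _ => ?_⟩
    simp only [eval, time]
    constructor <;> nlinarith [Nat.zero_le L, Nat.zero_le (Nat.size c)]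
  | inputLength =>
    refine ⟨1, fun L w s h => ?_⟩
    have := h.2.1
    simp only [eval, time]
    omega
  | input e ih =>
    obtain ⟨c, hc⟩ := ih
    refine ⟨c + 1, fun L w s h => ?_⟩
    obtain ⟨-, h2⟩ := hc L w s h
    have : Nat.size ((input e).eval w s) ≤ L := h.1 _
    simp only [time, add_mul]
    omega
  | get a e ih =>
    obtain ⟨c, hc⟩ := ih
    refine ⟨c + 1, fun L w s h => ?_⟩
    obtain ⟨-, h2⟩ := hc L w s h
    have : Nat.size ((get a e).eval w s) ≤ L := h.2.2 _ _
    simp only [time, add_mul]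
    omega
  | add e₁ e₂ h₁ h₂ =>
    obtain ⟨c₁, h₁⟩ := h₁
    obtain ⟨c₂, h₂⟩ := h₂
    refine ⟨2 * c₁ + 2 * c₂ + 2, fun L w s h => ?_⟩
    obtain ⟨a1, a2⟩ := h₁ L w s h
    obtain ⟨b1, b2⟩ := h₂ L w s h
    have : Nat.size ((add e₁ e₂).eval w s) ≤ (c₁ * (L + 1) + c₂ * (L + 1)) + 1 :=
      size_add_le (a1.trans (by omega)) (b1.trans (by omega))
    simp only [time, add_mul, mul_assoc] at *
    omega
  | sub e₁ e₂ h₁ h₂ =>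
    obtain ⟨c₁, h₁⟩ := h₁
    obtain ⟨c₂, h₂⟩ := h₂
    refine ⟨2 * c₁ + 2 * c₂ + 2, fun L w s h => ?_⟩
    obtain ⟨a1, a2⟩ := h₁ L w s h
    obtain ⟨b1, b2⟩ := h₂ L w s h
    have : Nat.size ((sub e₁ e₂).eval w s) ≤ c₁ * (L + 1) := size_sub_le a1
    simp only [time, add_mul, mul_assoc] at *
    omega
  | mul e₁ e₂ h₁ h₂ =>
    obtain ⟨c₁, h₁⟩ := h₁
    obtain ⟨c₂, h₂⟩ := h₂
    refine ⟨2 * c₁ + 2 * c₂ + 2, fun L w s h => ?_⟩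
    obtain ⟨a1, a2⟩ := h₁ L w s h
    obtain ⟨b1, b2⟩ := h₂ L w s h
    have : Nat.size ((mul e₁ e₂).eval w s) ≤ c₁ * (L + 1) + c₂ * (L + 1) :=
      size_mul_le a1 b1
    simp only [time, add_mul, mul_assoc] at *
    omega

end Expr

/-- Overwrite one cell. -/
def Store.write (s : Store) (a i x : ℕ) : Store :=
  Function.update s a (Function.update (s a) i x)

theorem Store.write_apply (s : Store) (a i x b j : ℕ) :
    s.write a i x b j = if b = a ∧ j = i then x else s b j := by
  unfold Store.write
  by_cases hb : b = a
  · subst hb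
    by_cases hj : j = i <;> simp [hj]
  · simp [hb]

theorem Store.write_of_ne (s : Store) {a b : ℕ} (i x : ℕ) (h : b ≠ a) : s.write a i x b = s b := by
  simp [Store.write, h]

theorem Sized.write {L : ℕ} {w : List ℕ} {s : Store} (h : Sized L w s) (a i : ℕ) {x : ℕ}
    (hx : Nat.size x ≤ L) : Sized L w (s.write a i x) := by
  refine ⟨h.1, h.2.1, fun b j => ?_⟩
  rw [Store.write_apply]
  split_ifs
  · exact hx
  · exact h.2.2 b j

/-- The program halts within a time that is bounded in terms of `K` and the bit lengths of the
numbers in the input and the memory, and makes these numbers at most `K` bits longer. -/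
def Runs (w : List ℕ) (p : Program) (s : Store) (K : ℕ) (s' : Store) : Prop :=
  ∀ L, Sized L w s → ∃ t, Exec w p s t s' ∧ t ≤ K * (L + K) ∧ Sized (L + K) w s'

theorem Runs.mono {w : List ℕ} {p : Program} {s s' : Store} {K K' : ℕ} (h : Runs w p s K s')
    (hK : K ≤ K') : Runs w p s K' s' := by
  intro L hL
  obtain ⟨t, h1, h2, h3⟩ := h L hL
  exact ⟨t, h1, h2.trans (Nat.mul_le_mul hK (by omega)), h3.mono (by omega)⟩

/-- The second program starts with numbers of length `L + K`, and `K * (L + K) + K' * (L + K + K') ≤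
(K + K') * (L + K + K')`. So a single parameter, additive under composition, controls both time and
growth. -/
theorem Runs.seq {w : List ℕ} {p q : Program} {s s' s'' : Store} {K K' : ℕ}
    (h : Runs w p s K s') (h' : Runs w q s' K' s'') : Runs w (.seq p q) s (K + K') s'' := by
  intro L hL
  obtain ⟨t, h1, h2, h3⟩ := h L hL
  obtain ⟨t', h1', h2', h3'⟩ := h' _ h3
  refine ⟨t + t', .seq h1 h1', ?_, h3'.mono (by omega)⟩
  nlinarith [Nat.zero_le (K * K')]

theorem exists_runs_set (a : ℕ) (e₁ : Expr) {e₂ : Expr} (he : e₂.Storable) :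
    ∃ K, ∀ w s, Runs w (.set a e₁ e₂) s K (s.write a (e₁.eval w s) (e₂.eval w s)) := by
  obtain ⟨c, hc⟩ := he.exists_size_eval_le
  obtain ⟨c₁, h₁⟩ := e₁.exists_time_le
  obtain ⟨c₂, h₂⟩ := e₂.exists_time_le
  refine ⟨c + c₁ + c₂ + 1, fun w s L hL => ⟨_, .set a e₁ e₂ s, ?_, ?_⟩⟩
  · have h1 := (h₁ L w s hL).2
    have h2 := (h₂ L w s hL).2
    have : (c₁ + c₂ + 1) * (L + 1) ≤ (c + c₁ + c₂ + 1) * (L + (c + c₁ + c₂ + 1)) :=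
      Nat.mul_le_mul (by omega) (by omega)
    simp only [add_mul _ _ (L + 1)] at this
    omega
  · exact (hL.mono (by omega)).write _ _ ((hc L w s hL).trans (by omega))

theorem exists_test_le (e : Expr) :
    ∃ c, ∀ w s K L, Sized L w s → ∀ t, t ≤ K * (L + K) →
      e.time w s + 1 + t ≤ (K + c) * (L + (K + c)) := by
  obtain ⟨c, hc⟩ := e.exists_time_le
  refine ⟨c + 1, fun w s K L hL t ht => ?_⟩
  have h1 := (hc L w s hL).2
  nlinarith [Nat.zero_le (K * c), Nat.zero_le (c * c), Nat.zero_le (c * L), Nat.zero_le (K * L)]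

/-! ### A language of counting loops and its polynomial time bound. -/

/-- Structured programs whose only loops are counting loops: `forN c p` runs `p` with the values
`0, …, n - 1` in cell `0` of array `c`, where `n` is the first number of the input. -/
inductive Prog : Type
  | skip : Prog
  | set (a : ℕ) (e₁ e₂ : Expr) : Prog
  | seq (p q : Prog) : Prog
  | ite (e : Expr) (p q : Prog) : Prog
  | forN (c : ℕ) (p : Prog) : Prog

namespace Prog

/-- Repeat `f`, counting the repetitions in cell `0` of array `c`. -/
def iter (c : ℕ) (f : Store → Store) (s : Store) : ℕ → Store
  | 0 => s.write c 0 0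
  | m + 1 => (f (iter c f s m)).write c 0 (m + 1)

/-- The memory after the execution of the program. -/
def sem (w : List ℕ) : Prog → Store → Store
  | skip, s => s
  | set a e₁ e₂, s => s.write a (e₁.eval w s) (e₂.eval w s)
  | seq p q, s => q.sem w (p.sem w s)
  | ite e p q, s => if e.eval w s ≠ 0 then p.sem w s else q.sem w s
  | forN c p, s => iter c (p.sem w) s (w.getD 0 0)

/-- The program contains an assignment to array `a`. -/
def Writes (a : ℕ) : Prog → Prop
  | skip => False
  | set b _ _ => a = b
  | seq p q => p.Writes a ∨ q.Writes a
  | ite _ p q => p.Writes a ∨ q.Writes a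
  | forN c p => a = c ∨ p.Writes a

/-- Only storable expressions are assigned, and loops do not modify their counters. -/
def WF : Prog → Prop
  | skip => True
  | set _ _ e => e.Storable
  | seq p q => p.WF ∧ q.WF
  | ite _ p q => p.WF ∧ q.WF
  | forN c p => ¬ p.Writes c ∧ p.WF

/-- The translation of counting loops to conditional loops. -/
def toProgram : Prog → Program
  | skip => .skip
  | set a e₁ e₂ => .set a e₁ e₂
  | seq p q => .seq p.toProgram q.toProgram
  | ite e p q => .ite e p.toProgram q.toProgram
  | forN c p => .seq (.set c (.const 0) (.const 0))
      (.loop (.sub (.input (.const 0)) (.get c (.const 0)))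
        (.seq p.toProgram (.set c (.const 0) (.add (.get c (.const 0)) (.const 1)))))

/-- The frame rule: it separates the arrays used by different parts of a program. -/
theorem sem_of_not_writes (w : List ℕ) {p : Prog} {a : ℕ} (h : ¬ p.Writes a) (s : Store) :
    p.sem w s a = s a := by
  induction p generalizing s with
  | skip => rfl
  | set b e₁ e₂ => exact Store.write_of_ne _ _ _ h
  | seq p q hp hq =>
    simp only [Writes, not_or] at h
    rw [sem, hq h.2, hp h.1]
  | ite e p q hp hq =>
    simp only [Writes, not_or] at h
    simp only [sem]
    split_ifs
    · exact hp h.1 s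
    · exact hq h.2 s
  | forN c p hp =>
    simp only [Writes, not_or] at h
    simp only [sem]
    induction w.getD 0 0 with
    | zero => exact Store.write_of_ne _ _ _ h.1
    | succ m ih => rw [iter, Store.write_of_ne _ _ _ h.1, hp h.2, ih]

theorem iter_counter (c : ℕ) (f : Store → Store) (s : Store) (m : ℕ) : iter c f s m c 0 = m := by
  cases m <;> simp [iter, Store.write_apply]

/-- The invariant rule for counting loops. -/
theorem forN_induction {w : List ℕ} {c : ℕ} {p : Prog} (P : ℕ → Store → Prop) {s : Store}
    (h0 : P 0 (s.write c 0 0))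
    (hs : ∀ m < w.getD 0 0, ∀ t, t c 0 = m → P m t → P (m + 1) ((p.sem w t).write c 0 (m + 1))) :
    P (w.getD 0 0) ((forN c p).sem w s) := by
  have : ∀ m ≤ w.getD 0 0, P m (iter c (p.sem w) s m) := by
    intro m
    induction m with
    | zero => exact fun _ => h0
    | succ m ih => exact fun hm => hs m hm _ (iter_counter _ _ _ _) (ih (by omega))
  exact this _ le_rfl

/-- The number of rounds is read from the read-only input, and the parameters of the rounds add up;
`k` pays for initialising, testing and incrementing the counter. -/
theorem exists_runs_forN {p : Prog} {c : ℕ} (hc : ¬ p.Writes c) :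
    ∃ k, ∀ w K, (∀ s, Runs w p.toProgram s K (p.sem w s)) →
      ∀ s, Runs w (forN c p).toProgram s (w.getD 0 0 * (K + k) + k) ((forN c p).sem w s) := by
  obtain ⟨k₀, h₀⟩ := exists_runs_set c (.const 0) (e₂ := .const 0) trivial
  obtain ⟨k₁, h₁⟩ := exists_runs_set c (.const 0) (e₂ := .add (.get c (.const 0)) (.const 1))
    ⟨trivial, trivial⟩
  obtain ⟨k₂, h₂⟩ := exists_test_le (.sub (.input (.const 0)) (.get c (.const 0)))
  refine ⟨k₀ + k₁ + k₂, fun w K hp s => ?_⟩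
  -- Here `m` rounds are done and `j` remain; the extra `k₂` pays for the final, failing test.
  have hloop : ∀ j m, j + m = w.getD 0 0 →
      Runs w (.loop (.sub (.input (.const 0)) (.get c (.const 0)))
        (.seq p.toProgram (.set c (.const 0) (.add (.get c (.const 0)) (.const 1)))))
        (iter c (p.sem w) s m) (j * (K + k₁ + k₂) + k₂) (iter c (p.sem w) s (w.getD 0 0)) := by
    intro j
    induction j with
    | zero =>
      intro m hm L hL
      rw [zero_add] at hm
      subst hm
      refine ⟨_, .loop_false ?_, ?_, hL.mono (by omega)⟩
      · simp [Expr.eval, iter_counter]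
      · simpa using h₂ w _ 0 L hL 0 (Nat.zero_le _)
    | succ j ih =>
      intro m hm
      have hbody := (hp (iter c (p.sem w) s m)).seq (h₁ w _)
      have hnext : (p.sem w (iter c (p.sem w) s m)).write c
          ((Expr.const 0).eval w (p.sem w (iter c (p.sem w) s m)))
          ((Expr.add (.get c (.const 0)) (.const 1)).eval w
            (p.sem w (iter c (p.sem w) s m))) = iter c (p.sem w) s (m + 1) := by
        simp only [Expr.eval, sem_of_not_writes w hc, iter_counter]
        rfl
      rw [hnext] at hbody
      intro L hL
      obtain ⟨t, e1, b1, z1⟩ := hbody L hL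
      obtain ⟨t', e2, b2, z2⟩ := ih (m + 1) (by omega) _ z1
      refine ⟨_, .loop_true ?_ e1 e2, ?_, z2.mono (by linarith)⟩
      · simp only [Expr.eval, iter_counter]
        omega
      · have h3 := h₂ w _ _ L hL t b1
        have h4 : (K + k₁ + k₂) * (L + (K + k₁ + k₂)) +
            (j * (K + k₁ + k₂) + k₂) * (L + (K + k₁) + (j * (K + k₁ + k₂) + k₂)) ≤
            ((j + 1) * (K + k₁ + k₂) + k₂) * (L + ((j + 1) * (K + k₁ + k₂) + k₂)) := by
          have e : (j + 1) * (K + k₁ + k₂) + k₂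
              = (K + k₁ + k₂) + (j * (K + k₁ + k₂) + k₂) := by ring
          rw [e, add_mul (K + k₁ + k₂) (j * (K + k₁ + k₂) + k₂)]
          exact Nat.add_le_add (Nat.mul_le_mul le_rfl (by omega))
            (Nat.mul_le_mul le_rfl (by omega))
        exact le_trans (Nat.add_le_add h3 b2) h4
  refine ((h₀ w s).seq (hloop _ 0 (add_zero _))).mono ?_
  have := Nat.mul_le_mul_left (w.getD 0 0) (show K + k₁ + k₂ ≤ K + (k₀ + k₁ + k₂) by omega)
  omega

/-- A well-formed structured program runs in polynomial time. -/
theorem WF.exists_runs {p : Prog} (h : p.WF) :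
    ∃ q : Polynomial ℕ, ∀ w s, Runs w p.toProgram s (q.eval (w.getD 0 0)) (p.sem w s) := by
  induction p with
  | skip =>
    refine ⟨1, fun w s L hL => ⟨1, .skip s, ?_, hL.mono (by omega)⟩⟩
    simp
  | set a e₁ e₂ =>
    obtain ⟨K, hK⟩ := exists_runs_set a e₁ h
    exact ⟨.C K, fun w s => by rw [Polynomial.eval_C]; exact hK w s⟩
  | seq p q hp hq =>
    obtain ⟨f, hf⟩ := hp h.1
    obtain ⟨g, hg⟩ := hq h.2
    refine ⟨f + g, fun w s => ?_⟩
    rw [Polynomial.eval_add]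
    exact (hf w s).seq (hg w _)
  | ite e p q hp hq =>
    obtain ⟨f, hf⟩ := hp h.1
    obtain ⟨g, hg⟩ := hq h.2
    obtain ⟨c, hc⟩ := exists_test_le e
    refine ⟨f + g + .C c, fun w s L hL => ?_⟩
    simp only [Polynomial.eval_add, Polynomial.eval_C, sem, toProgram]
    split_ifs with he
    · obtain ⟨t, h1, h2, h3⟩ := (hf w s).mono (Nat.le_add_right _ (g.eval (w.getD 0 0))) L hL
      exact ⟨_, .ite_true he h1, hc w s _ L hL t h2, h3.mono (by omega)⟩
    · obtain ⟨t, h1, h2, h3⟩ := (hg w s).mono (Nat.le_add_left _ (f.eval (w.getD 0 0))) L hL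
      exact ⟨_, .ite_false (not_not.1 he) h1, hc w s _ L hL t h2, h3.mono (by omega)⟩
  | forN c p hp =>
    obtain ⟨f, hf⟩ := hp h.2
    obtain ⟨k, hk⟩ := exists_runs_forN h.1
    refine ⟨.X * (f + .C k) + .C k, fun w s => ?_⟩
    simpa using hk w _ (hf w) s

end Prog

theorem size_getD_le_inputSize (w : List ℕ) (i : ℕ) : Nat.size (w.getD i 0) ≤ inputSize w := by
  by_cases hi : i < w.length
  · rw [List.getD_eq_getElem _ _ hi]
    have : Nat.size w[i] + 1 ∈ w.map fun x => Nat.size x + 1 :=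
      List.mem_map.2 ⟨_, List.getElem_mem hi, rfl⟩
    have := List.le_sum_of_mem this
    unfold inputSize
    omega
  · rw [List.getD_eq_default _ _ (by omega)]
    simp

theorem length_le_inputSize (w : List ℕ) : w.length ≤ inputSize w := by
  induction w with
  | nil => simp
  | cons x w ih =>
    simp only [inputSize, List.length_cons, List.map_cons, List.sum_cons] at *
    omega

theorem monotone_eval_nat (q : Polynomial ℕ) : Monotone fun n => q.eval n := by
  intro m n h
  simp only [Polynomial.eval_eq_sum_range]
  gcongr

/-- A problem is solvable in polynomial time if a structured program decides it, provided that the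
number of iterations of the counting loops does not exceed the size of the input. -/
theorem PolyTimeDecidable.of_prog {ι : Type} {encode : ι → List ℕ} {P : ι → Prop} {p : Prog}
    (hp : p.WF) (hn : ∀ x, (encode x).getD 0 0 ≤ inputSize (encode x))
    (h : ∀ x, p.sem (encode x) (fun _ _ => 0) 0 0 ≠ 0 ↔ P x) : PolyTimeDecidable encode P := by
  obtain ⟨q, hq⟩ := hp.exists_runs
  -- This is the bound `K * (L + K)` of `Runs`, with the input size for `L` and `q` of it for `K`.
  refine ⟨p.toProgram, q * (.X + q), fun x => ?_⟩
  obtain ⟨t, h1, h2, -⟩ := (hq (encode x) fun _ _ => 0).mono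
    (monotone_eval_nat q (hn x)) (inputSize (encode x))
    ⟨size_getD_le_inputSize _, (Nat.size_le.2 Nat.lt_two_pow_self).trans
      (length_le_inputSize _), fun _ _ => by simp⟩
  exact ⟨t, _, h1, by simpa using h2, h x⟩

end RAM

/-! ### Reachability and greedy cost on encoded elections. -/

namespace RAM

/-- Vertices reachable by at most `r` steps. -/
def Within (R : ℕ → ℕ → Prop) (i : ℕ) : ℕ → ℕ → Prop
  | 0, x => x = i
  | r + 1, x => Within R i r x ∨ ∃ j, Within R i r j ∧ R j x

/-- The sets reached within `r` steps increase inside `{0, …, n - 1}`, and once a round adds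
nothing, no later round does. So they are stable after `n` rounds. -/
theorem Within.of_reflTransGen {R : ℕ → ℕ → Prop} {n i x : ℕ} (hR : ∀ j k, R j k → k < n)
    (hi : i < n) (h : Relation.ReflTransGen R i x) : Within R i n x := by
  classical
  have hlt : ∀ r x, Within R i r x → x < n := by
    intro r
    induction r with
    | zero => rintro x rfl; exact hi
    | succ r ih =>
      rintro x (h | ⟨j, -, h⟩)
      · exact ih x h
      · exact hR j x h
  let S : ℕ → Finset ℕ := fun r => {x ∈ Finset.range n | Within R i r x}
  have hS : ∀ r x, x ∈ S r ↔ Within R i r x := fun r x => by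
    simpa [S] using hlt r x
  have hsub : ∀ r, S r ⊆ S (r + 1) := fun r x hx => (hS _ x).2 (Or.inl ((hS r x).1 hx))
  have hstab : ∀ r, S r = S (r + 1) → S (r + 1) = S (r + 2) := by
    intro r h
    refine (hsub _).antisymm fun x hx => ?_
    rcases (hS _ x).1 hx with h' | ⟨j, hj, hjx⟩
    · exact (hS _ x).2 h'
    · refine (hS _ x).2 (Or.inr ⟨j, ?_, hjx⟩)
      rw [← hS] at hj ⊢
      rwa [h]
  have hcard := Nat.stabilises_of_monotone (f := fun r => (S r).card) (b := n) (n := n + 1)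
    (monotone_nat_of_le_succ fun r => Finset.card_le_card (hsub r))
    (fun r => (Finset.card_filter_le _ _).trans (by simp))
    (fun r hr => by
      have h1 := Finset.eq_of_subset_of_card_le (hsub r) (le_of_eq hr.symm)
      exact congrArg Finset.card (hstab r h1)) (by omega)
  have heq := Finset.eq_of_subset_of_card_le (hsub n) (le_of_eq hcard)
  have hzero : ∀ r, Within R i r i := by
    intro r
    induction r with
    | zero => rfl
    | succ r ih => exact Or.inl ih
  induction h with
  | refl => exact hzero n
  | tail _ hbc ih =>
    rw [← hS, heq, hS]
    exact Or.inr ⟨_, ih, hbc⟩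

/-- The number of voters. -/
abbrev numE : Expr := .input (.const 0)

/-- The register in cell `0` of array `a`. -/
abbrev reg (a : ℕ) : Expr := .get a (.const 0)

abbrev votingCostE (e : Expr) : Expr := .input (.add (.const 2) e)

abbrev delegatingCostE (e : Expr) : Expr := .input (.add (.add (.const 2) numE) e)

/-- Nonzero if there is an edge from `e` to `f`, and neither voter is excluded. -/
abbrev edgeE (e f : Expr) : Expr :=
  .mul (.input (.add (.add (.add (.const 2) numE) numE) (.add (.mul e numE) f)))
    (.mul (.sub (.const 1) (.get 1 e)) (.sub (.const 1) (.get 1 f)))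

section Words

variable (w : List ℕ)

def votingCost (i : ℕ) : ℕ := w.getD (2 + i) 0

def delegatingCost (i : ℕ) : ℕ := w.getD (2 + w.getD 0 0 + i) 0

/-- The edges between voters that are not excluded. -/
def Edge (Z : Set ℕ) (j k : ℕ) : Prop :=
  (j < w.getD 0 0 ∧ k < w.getD 0 0) ∧
    w.getD (2 + w.getD 0 0 + w.getD 0 0 + (j * w.getD 0 0 + k)) 0 ≠ 0 ∧ j ∉ Z ∧ k ∉ Z

/-- `CLDElection.GreedyCast` for encoded elections without the voters in `Z`. -/
def WordCast (Z : Set ℕ) (i : ℕ) : Prop :=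
  votingCost w i - delegatingCost w i = 0 ∨ ∀ j < w.getD 0 0,
    Relation.ReflTransGen (Edge w Z) i j → Relation.ReflTransGen (Edge w Z) j i ∧
      (votingCost w i - delegatingCost w i < votingCost w j - delegatingCost w j ∨
        votingCost w i - delegatingCost w i = votingCost w j - delegatingCost w j ∧ i ≤ j)

open Classical in
/-- The cost of the greedy solution in the first `m` voters. -/
noncomputable def greedyCost (Z : Set ℕ) (m : ℕ) : ℕ :=
  ∑ i ∈ Finset.range m, if i ∈ Z then 0 else
    if WordCast w Z i then votingCost w i else delegatingCost w i

end Words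

/-! ### Programs for reachability and for the greedy cost. -/

namespace Prog

/-- Mark in array `m` what is reachable from the vertex in register `6`, if the value of `g` tells
the adjacency of the vertices in the registers `8` and `9`. -/
def closure (m : ℕ) (g : Expr) : Prog :=
  .seq (.forN 8 (.set m (reg 8) (.const 0)))
    (.seq (.set m (reg 6) (.const 1))
      (.forN 7 (.forN 8 (.forN 9 (.ite (.mul (.get m (reg 8)) g)
        (.set m (reg 9) (.const 1)) .skip)))))

/-- Marks set during a round may be used in the same round, so after `r` rounds the marked set need
not equal `Within R i r`. The invariant encloses it instead: every mark is reachable (`Sound`), and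
everything within `r` steps is marked. After `n` rounds the two bounds coincide. The condition `t 1
= s 1` is there because array `1`, which records the excluded voters, enters the adjacency test. -/
theorem closure_sem {w : List ℕ} {m : ℕ} {g : Expr} {R : ℕ → ℕ → Prop} {s : Store}
    (hm : m ≠ 1 ∧ m ≠ 6 ∧ m ≠ 7 ∧ m ≠ 8 ∧ m ≠ 9) (hi : s 6 0 < w.getD 0 0)
    (hR : ∀ j k, R j k → j < w.getD 0 0 ∧ k < w.getD 0 0)
    (hg : ∀ t : Store, t 1 = s 1 → t 8 0 < w.getD 0 0 → t 9 0 < w.getD 0 0 →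
      (g.eval w t ≠ 0 ↔ R (t 8 0) (t 9 0))) {x : ℕ} (hx : x < w.getD 0 0) :
    (closure m g).sem w s m x ≠ 0 ↔ Relation.ReflTransGen R (s 6 0) x := by
  obtain ⟨hm1, hm6, hm7, hm8, hm9⟩ := hm
  set n := w.getD 0 0 with hn
  set i := s 6 0 with hi0
  let Sound : Store → Prop := fun t =>
    t 1 = s 1 ∧ ∀ x < n, t m x ≠ 0 → Relation.ReflTransGen R i x
  have hsound : ∀ (t : Store) c y, c ≠ 1 → c ≠ m → Sound t → Sound (t.write c 0 y) := by
    intro t c y h1 h2 ht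
    simpa only [Sound, Store.write_of_ne _ _ _ h1.symm, Store.write_of_ne _ _ _ h2.symm] using ht
  -- clearing
  have hclear : ∀ x < n, (forN 8 (.set m (reg 8) (.const 0))).sem w s m x = 0 := by
    refine forN_induction (fun r t => ∀ x < r, t m x = 0) (by simp) fun r _ t hr ht x hx => ?_
    rw [Store.write_of_ne _ _ _ hm8]
    simp only [sem, Expr.eval, hr, Store.write_apply, true_and]
    split_ifs with h
    · rfl
    · exact ht x (by omega)
  have hclear' : ∀ a, a ≠ m → a ≠ 8 → (forN 8 (.set m (reg 8) (.const 0))).sem w s a = s a :=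
    fun a h1 h2 => sem_of_not_writes w (by simp [Writes, h1, h2]) s
  -- one vertex
  have hinner : ∀ t, Sound t → t 8 0 < n →
      let u := (forN 9 (.ite (.mul (.get m (reg 8)) g) (.set m (reg 9) (.const 1)) .skip)).sem w t
      Sound u ∧ u 8 0 = t 8 0 ∧ (∀ x, t m x ≠ 0 → u m x ≠ 0) ∧
        ∀ k < n, t m (t 8 0) ≠ 0 → R (t 8 0) k → u m k ≠ 0 := by
    intro t ht htn
    refine forN_induction (fun r u => Sound u ∧ u 8 0 = t 8 0 ∧ (∀ x, t m x ≠ 0 → u m x ≠ 0) ∧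
        ∀ k < r, t m (t 8 0) ≠ 0 → R (t 8 0) k → u m k ≠ 0) ?_ ?_
    · refine ⟨hsound _ _ _ (by decide) hm9.symm ht, ?_, ?_, by simp⟩
      · simp [Store.write_apply]
      · simp [Store.write_of_ne _ _ _ hm9]
    · rintro r hr u hur ⟨h1, h2, h3, h4⟩
      have hgu := hg u h1.1 (h2 ▸ htn) (hur ▸ hr)
      rw [h2, hur] at hgu
      have key : Sound ((ite (.mul (.get m (reg 8)) g) (.set m (reg 9) (.const 1)) .skip).sem w u) ∧
          (ite (.mul (.get m (reg 8)) g) (.set m (reg 9) (.const 1)) .skip).sem w u 8 0 = t 8 0 ∧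
          ∀ x, (ite (.mul (.get m (reg 8)) g) (.set m (reg 9) (.const 1)) .skip).sem w u m x ≠ 0
            ↔ u m x ≠ 0 ∨ u m (t 8 0) ≠ 0 ∧ R (t 8 0) r ∧ x = r := by
        by_cases hc : u m (t 8 0) ≠ 0 ∧ R (t 8 0) r
        · have he : (Expr.mul (.get m (reg 8)) g).eval w u ≠ 0 := by
            simp only [Expr.eval, h2]
            exact mul_ne_zero hc.1 (hgu.2 hc.2)
          rw [sem, if_pos he]
          simp only [sem, Expr.eval, hur]
          have hmark : ∀ x, u.write m r 1 m x ≠ 0 ↔ u m x ≠ 0 ∨ x = r := by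
            intro x
            rw [Store.write_apply]
            by_cases hxr : x = r <;> simp [hxr]
          refine ⟨⟨?_, ?_⟩, ?_, ?_⟩
          · rw [Store.write_of_ne _ _ _ hm1.symm, h1.1]
          · intro x hx hxm
            rcases (hmark x).1 hxm with h | rfl
            · exact h1.2 x hx h
            · exact (h1.2 _ htn hc.1).tail hc.2
          · rw [Store.write_of_ne _ _ _ hm8.symm, h2]
          · intro x
            rw [hmark]
            simp [hc.1, hc.2]
        · have he : (Expr.mul (.get m (reg 8)) g).eval w u = 0 := by
            by_contra he
            simp only [Expr.eval, h2] at he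
            exact hc ⟨left_ne_zero_of_mul he, hgu.1 (right_ne_zero_of_mul he)⟩
          rw [sem, if_neg (not_not.2 he)]
          exact ⟨h1, h2, fun x => ⟨Or.inl, fun h => h.resolve_right fun h' => hc ⟨h'.1, h'.2.1⟩⟩⟩
      obtain ⟨k1, k2, k3⟩ := key
      refine ⟨hsound _ _ _ (by decide) hm9.symm k1, ?_, ?_, ?_⟩
      · rw [Store.write_of_ne _ _ _ (by decide), k2]
      · intro x hx
        rw [Store.write_of_ne _ _ _ hm9, k3]
        exact Or.inl (h3 x hx)
      · intro k hk hj hjk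
        rw [Store.write_of_ne _ _ _ hm9, k3]
        rcases Nat.lt_succ_iff_lt_or_eq.1 hk with h | rfl
        · exact Or.inl (h4 k h hj hjk)
        · exact Or.inr ⟨h3 _ hj, hjk, rfl⟩
  -- one round
  have hround : ∀ t, Sound t →
      let u := (forN 8 (forN 9 (.ite (.mul (.get m (reg 8)) g)
        (.set m (reg 9) (.const 1)) .skip))).sem w t
      Sound u ∧ (∀ x, t m x ≠ 0 → u m x ≠ 0) ∧
        ∀ j < n, ∀ k < n, t m j ≠ 0 → R j k → u m k ≠ 0 := by
    intro t ht
    refine forN_induction (fun r u => Sound u ∧ (∀ x, t m x ≠ 0 → u m x ≠ 0) ∧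
        ∀ j < r, ∀ k < n, t m j ≠ 0 → R j k → u m k ≠ 0) ?_ ?_
    · exact ⟨hsound _ _ _ (by decide) hm8.symm ht, by simp [Store.write_of_ne _ _ _ hm8], by simp⟩
    · rintro r hr u hur ⟨h1, h2, h3⟩
      obtain ⟨k1, -, k3, k4⟩ := hinner u h1 (hur ▸ hr)
      rw [hur] at k4
      rw [Store.write_of_ne _ _ _ hm8]
      refine ⟨hsound _ _ _ (by decide) hm8.symm k1, fun x hx => k3 x (h2 x hx), ?_⟩
      intro j hj k hk hjm hjk
      rcases Nat.lt_succ_iff_lt_or_eq.1 hj with h | rfl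
      · exact k3 k (h3 j h k hk hjm hjk)
      · exact k4 k hk (h2 _ hjm) hjk
  have hfinal : Sound ((closure m g).sem w s) ∧
      ∀ x, Within R i n x → (closure m g).sem w s m x ≠ 0 := by
    refine forN_induction (fun r u => Sound u ∧ ∀ x, Within R i r x → u m x ≠ 0) ?_ ?_
    · rw [sem]
      simp only [Expr.eval, hclear' 6 hm6.symm (by decide)]
      constructor
      · refine hsound _ _ _ (by decide) hm7.symm ⟨?_, ?_⟩
        · rw [Store.write_of_ne _ _ _ hm1.symm, hclear' 1 hm1.symm (by decide)]
        · intro x hx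
          rw [Store.write_apply]
          split_ifs with h
          · rw [h.2]
            exact fun _ => .refl
          · exact fun h' => absurd (hclear x hx) h'
      · rintro x rfl
        rw [Store.write_of_ne _ _ _ hm7, Store.write_apply, if_pos ⟨rfl, rfl⟩]
        exact one_ne_zero
    · rintro r hr u hur ⟨h1, h2⟩
      obtain ⟨k1, k2, k3⟩ := hround u h1
      rw [Store.write_of_ne _ _ _ hm7]
      refine ⟨hsound _ _ _ (by decide) hm7.symm k1, ?_⟩
      rintro x (h | ⟨j, hj, hjx⟩)
      · exact k2 x (h2 x h)
      · exact k3 j (hR j x hjx).1 x (hR j x hjx).2 (h2 j hj) hjx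
  exact ⟨hfinal.1.2 x hx, fun h =>
    hfinal.2 x (Within.of_reflTransGen (fun j k hjk => (hR j k hjk).2) hi h)⟩

/-- Set register `5` to a nonzero value if and only if every vertex marked in array `2` is marked in
array `3` and does not precede the voter in register `6` in the order by surcharges. -/
def checkMinimal : Prog :=
  .seq (.set 5 (.const 0) (.const 1))
    (.forN 8 (.ite (.mul (.get 2 (reg 8))
      (.add (.sub (.const 1) (.get 3 (reg 8)))
        (.add (.sub (.sub (votingCostE (reg 6)) (delegatingCostE (reg 6)))
            (.sub (votingCostE (reg 8)) (delegatingCostE (reg 8))))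
          (.mul (.sub (.const 1) (.sub (.sub (votingCostE (reg 8)) (delegatingCostE (reg 8)))
              (.sub (votingCostE (reg 6)) (delegatingCostE (reg 6)))))
            (.sub (reg 6) (reg 8))))))
      (.set 5 (.const 0) (.const 0)) .skip))

theorem checkMinimal_sem (w : List ℕ) (s : Store) :
    checkMinimal.sem w s 5 0 ≠ 0 ↔ ∀ j < w.getD 0 0, s 2 j ≠ 0 → s 3 j ≠ 0 ∧
      (votingCost w (s 6 0) - delegatingCost w (s 6 0) < votingCost w j - delegatingCost w j ∨
        votingCost w (s 6 0) - delegatingCost w (s 6 0) = votingCost w j - delegatingCost w j ∧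
          s 6 0 ≤ j) := by
  -- In truncated arithmetic the second factor of the test is nonzero exactly if voter `8` is
  -- unmarked in array `3`, or has smaller surcharge than voter `6`, or has no larger surcharge and
  -- smaller index: `1 - (b - a)` is nonzero iff `b ≤ a`.
  have := forN_induction (w := w) (c := 8) (p := .ite (.mul (.get 2 (reg 8))
      (.add (.sub (.const 1) (.get 3 (reg 8)))
        (.add (.sub (.sub (votingCostE (reg 6)) (delegatingCostE (reg 6)))
            (.sub (votingCostE (reg 8)) (delegatingCostE (reg 8))))
          (.mul (.sub (.const 1) (.sub (.sub (votingCostE (reg 8)) (delegatingCostE (reg 8)))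
              (.sub (votingCostE (reg 6)) (delegatingCostE (reg 6)))))
            (.sub (reg 6) (reg 8))))))
      (.set 5 (.const 0) (.const 0)) .skip)
    (fun m t => t 2 = s 2 ∧ t 3 = s 3 ∧ t 6 = s 6 ∧
      (t 5 0 ≠ 0 ↔ ∀ j < m, s 2 j ≠ 0 → s 3 j ≠ 0 ∧
      (votingCost w (s 6 0) - delegatingCost w (s 6 0) < votingCost w j - delegatingCost w j ∨
        votingCost w (s 6 0) - delegatingCost w (s 6 0) = votingCost w j - delegatingCost w j ∧
          s 6 0 ≤ j))) (s := s.write 5 0 1) ?_ ?_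
  · exact this.2.2.2
  · simp [Store.write_of_ne, Store.write_apply]
  · rintro m hm t htm ⟨h2, h3, h6, h5⟩
    rw [sem]
    split_ifs with hc
    · simp only [Expr.eval, htm, h2, h3, h6] at hc
      have ha := left_ne_zero_of_mul hc
      have hb := right_ne_zero_of_mul hc
      refine ⟨?_, ?_, ?_, ?_⟩
      · simp [sem, Store.write_of_ne, h2]
      · simp [sem, Store.write_of_ne, h3]
      · simp [sem, Store.write_of_ne, h6]
      · refine iff_of_false (by simp [sem, Expr.eval, Store.write_apply]) fun h => ?_
        obtain ⟨h3', hl⟩ := h m (by omega) ha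
        apply hb
        simp only [votingCost, delegatingCost] at hl
        rw [add_eq_zero, add_eq_zero, mul_eq_zero]
        omega
    · simp only [Expr.eval, htm, h2, h3, h6, not_not, mul_eq_zero] at hc
      refine ⟨?_, ?_, ?_, ?_⟩
      · simp [sem, Store.write_of_ne, h2]
      · simp [sem, Store.write_of_ne, h3]
      · simp [sem, Store.write_of_ne, h6]
      · simp only [sem]
        rw [Store.write_of_ne _ _ _ (by decide), h5]
        refine ⟨fun h j hj hj2 => ?_, fun h j hj => h j (by omega)⟩
        rcases Nat.lt_succ_iff_lt_or_eq.1 hj with hj | rfl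
        · exact h j hj hj2
        · have hc' := hc.resolve_left hj2
          rw [add_eq_zero, add_eq_zero, mul_eq_zero] at hc'
          simp only [votingCost, delegatingCost]
          omega

/-- Add to register `4` the voting cost or the delegating cost of the voter in register `6`,
depending on register `5`. -/
def payment : Prog :=
  .ite (.add (reg 5) (.sub (.const 1) (.sub (votingCostE (reg 6)) (delegatingCostE (reg 6)))))
    (.set 4 (.const 0) (.add (reg 4) (votingCostE (reg 6))))
    (.set 4 (.const 0) (.add (reg 4) (delegatingCostE (reg 6))))

/-- Add to register `4` what the voter in register `6` pays in the greedy solution. -/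
def voter : Prog :=
  .ite (.get 1 (reg 6)) .skip
    (.seq (closure 2 (edgeE (reg 8) (reg 9)))
      (.seq (closure 3 (edgeE (reg 9) (reg 8)))
        (.seq checkMinimal
          payment)))

open Classical in
theorem voter_sem {w : List ℕ} {s : Store} (hi : s 6 0 < w.getD 0 0) :
    voter.sem w s 4 0 = s 4 0 + if s 6 0 ∈ {x | s 1 x ≠ 0} then 0 else
      if WordCast w {x | s 1 x ≠ 0} (s 6 0) then votingCost w (s 6 0)
        else delegatingCost w (s 6 0) := by
  have hedge : ∀ t : Store, t 1 = s 1 → t 8 0 < w.getD 0 0 → t 9 0 < w.getD 0 0 →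
      ((edgeE (reg 8) (reg 9)).eval w t ≠ 0 ↔ Edge w {x | s 1 x ≠ 0} (t 8 0) (t 9 0)) ∧
      ((edgeE (reg 9) (reg 8)).eval w t ≠ 0 ↔ Edge w {x | s 1 x ≠ 0} (t 9 0) (t 8 0)) := by
    intro t ht h8 h9
    have hsub : ∀ x : ℕ, 1 - x ≠ 0 ↔ ¬ x ≠ 0 := by omega
    simp only [Expr.eval, ht, Edge, mul_ne_zero_iff, hsub, h8, h9, Set.mem_ofPred_eq, true_and,
      and_self]
  by_cases h1 : (Expr.get 1 (reg 6)).eval w s ≠ 0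
  · rw [voter, sem, if_pos h1, if_pos (show s 6 0 ∈ {x | s 1 x ≠ 0} from h1)]
    rfl
  · rw [voter, sem, if_neg h1, if_neg (show s 6 0 ∉ {x | s 1 x ≠ 0} from h1)]
    set s₁ := (closure 2 (edgeE (reg 8) (reg 9))).sem w s with hs₁
    set s₂ := (closure 3 (edgeE (reg 9) (reg 8))).sem w s₁ with hs₂
    set s₃ := checkMinimal.sem w s₂ with hs₃
    have f₁ : ∀ a, a ∉ ({2, 7, 8, 9} : Finset ℕ) → s₁ a = s a := fun a ha =>
      sem_of_not_writes w (by simp [closure, Writes] at ha ⊢; tauto) s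
    have f₂ : ∀ a, a ∉ ({3, 7, 8, 9} : Finset ℕ) → s₂ a = s₁ a := fun a ha =>
      sem_of_not_writes w (by simp [closure, Writes] at ha ⊢; tauto) s₁
    have f₃ : ∀ a, a ∉ ({5, 8} : Finset ℕ) → s₃ a = s₂ a := fun a ha =>
      sem_of_not_writes w (by simp [checkMinimal, Writes] at ha ⊢; tauto) s₂
    have e₁ : ∀ x < w.getD 0 0, s₁ 2 x ≠ 0 ↔
        Relation.ReflTransGen (Edge w {x | s 1 x ≠ 0}) (s 6 0) x := fun x hx =>
      closure_sem (by decide) hi (fun j k h => h.1) (fun t h h8 h9 => (hedge t h h8 h9).1) hx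
    have e₂ : ∀ x < w.getD 0 0, s₂ 3 x ≠ 0 ↔
        Relation.ReflTransGen (Edge w {x | s 1 x ≠ 0}) x (s 6 0) := by
      intro x hx
      have h16 : s₁ 6 = s 6 := f₁ 6 (by decide)
      have h11 : s₁ 1 = s 1 := f₁ 1 (by decide)
      -- Exchanging the arguments of the edge test computes the vertices from which the voter can be
      -- reached.
      rw [hs₂, closure_sem (R := Function.swap (Edge w {x | s 1 x ≠ 0})) (by decide) (h16 ▸ hi)
        (fun j k h => h.1.symm) (fun t h h8 h9 => (hedge t (h.trans h11) h8 h9).2) hx,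
        Relation.reflTransGen_swap, h16]
    have e₃ := checkMinimal_sem w s₂
    have h26 : s₂ 6 = s 6 := (f₂ 6 (by decide)).trans (f₁ 6 (by decide))
    have h36 : s₃ 6 = s 6 := (f₃ 6 (by decide)).trans h26
    have h34 : s₃ 4 = s 4 := (f₃ 4 (by decide)).trans ((f₂ 4 (by decide)).trans (f₁ 4 (by decide)))
    have h22 : s₂ 2 = s₁ 2 := f₂ 2 (by decide)
    have hcast : s₃ 5 0 + (1 - (votingCost w (s 6 0) - delegatingCost w (s 6 0))) ≠ 0 ↔
        WordCast w {x | s 1 x ≠ 0} (s 6 0) := by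
      have hor : ∀ a b : ℕ, a + (1 - b) ≠ 0 ↔ b = 0 ∨ a ≠ 0 := by omega
      rw [hor, WordCast, hs₃, e₃, h22, h26]
      refine or_congr Iff.rfl (forall_congr' fun j => forall_congr' fun hj => ?_)
      rw [e₁ j hj, e₂ j hj]
    have hval : (Expr.add (reg 5) (.sub (.const 1)
        (.sub (votingCostE (reg 6)) (delegatingCostE (reg 6))))).eval w s₃ ≠ 0 ↔
        WordCast w {x | s 1 x ≠ 0} (s 6 0) := by
      simpa only [Expr.eval, h36, votingCost, delegatingCost] using hcast
    change payment.sem w s₃ 4 0 = _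
    rw [payment, sem]
    by_cases hw : WordCast w {x | s 1 x ≠ 0} (s 6 0)
    · rw [if_pos (hval.2 hw), if_pos hw]
      simp [sem, Expr.eval, Store.write_apply, h34, h36, votingCost]
    · rw [if_neg (mt hval.1 hw), if_neg hw]
      simp [sem, Expr.eval, Store.write_apply, h34, h36, delegatingCost]

end Prog

end RAM

/-! ### Budget test and enumeration of the excluded sets. -/

namespace RAM

namespace Prog

/-- Store in register `4` the cost of the greedy solution. -/
def total : Prog := .seq (.set 4 (.const 0) (.const 0)) (.forN 6 voter)

theorem voter_sem_excluded (w : List ℕ) (s : Store) : voter.sem w s 1 = s 1 :=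
  sem_of_not_writes w (by simp [voter, payment, closure, checkMinimal, Writes]) s

open Classical in
theorem total_sem (w : List ℕ) (s : Store) :
    total.sem w s 4 0 = greedyCost w {x | s 1 x ≠ 0} (w.getD 0 0) := by
  refine (forN_induction (fun m t => t 1 = s 1 ∧ t 4 0 = greedyCost w {x | s 1 x ≠ 0} m) ?_ ?_).2
  · simp [Store.write_of_ne, Store.write_apply, sem, Expr.eval, greedyCost]
  · rintro m hm t h6 ⟨h1, h4⟩
    rw [Store.write_of_ne _ _ _ (by decide), Store.write_of_ne _ _ _ (by decide),
      voter_sem_excluded, voter_sem (h6 ▸ hm), h1, h4, h6]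
    refine ⟨rfl, ?_⟩
    rw [greedyCost, greedyCost, Finset.sum_range_succ]
    congr 1
    split_ifs <;> rfl

/-- Set register `0` to a nonzero value if the greedy solution stays within the budget. -/
def evaluate : Prog :=
  .seq total (.ite (.sub (.const 1) (.sub (reg 4) (.input (.const 1))))
    (.set 0 (.const 0) (.const 1)) .skip)

theorem evaluate_sem (w : List ℕ) (s : Store) : evaluate.sem w s 0 0 ≠ 0 ↔
    s 0 0 ≠ 0 ∨ greedyCost w {x | s 1 x ≠ 0} (w.getD 0 0) ≤ w.getD 1 0 := by
  have h0 : total.sem w s 0 = s 0 :=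
    sem_of_not_writes w (by simp [total, voter, payment, closure, checkMinimal, Writes]) s
  rw [evaluate, sem, sem]
  have h : (Expr.sub (.const 1) (.sub (reg 4) (.input (.const 1)))).eval w (total.sem w s) ≠ 0 ↔
      greedyCost w {x | s 1 x ≠ 0} (w.getD 0 0) ≤ w.getD 1 0 := by
    simp only [Expr.eval, total_sem]
    omega
  by_cases hc : greedyCost w {x | s 1 x ≠ 0} (w.getD 0 0) ≤ w.getD 1 0
  · rw [if_pos (h.2 hc)]
    exact iff_of_true (by simp [sem, Expr.eval, Store.write_apply]) (Or.inr hc)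
  · rw [if_neg (mt h.1 hc)]
    rw [sem, h0, or_iff_left hc]

/-- Try all ways to exclude at most `k` more voters. -/
def abstain : ℕ → Prog
  | 0 => evaluate
  | k + 1 => .seq (abstain k) (.forN (10 + k)
      (.seq (.set 1 (reg (10 + k)) (.add (.get 1 (reg (10 + k))) (.const 1)))
        (.seq (abstain k)
          (.set 1 (reg (10 + k)) (.sub (.get 1 (reg (10 + k))) (.const 1))))))

/-- Level `k` of the recursion uses only arrays below `10 + k`, so array `10 + k` is free to count
the loop of the next level. -/
theorem not_writes_abstain (k a : ℕ) (h : 10 + k ≤ a) : ¬ (abstain k).Writes a := by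
  induction k with
  | zero =>
    simp only [abstain, evaluate, total, voter, payment, closure, checkMinimal, Writes]
    grind (splits := 40)
  | succ k ih =>
    have := ih (by omega)
    simp only [abstain, Writes, this]
    grind

theorem wf_abstain (k : ℕ) : (abstain k).WF := by
  induction k with
  | zero =>
    simp [abstain, evaluate, total, voter, payment, closure, checkMinimal, Writes, WF, Expr.Storable]
  | succ k ih =>
    have := not_writes_abstain k (10 + k) le_rfl
    have h1 : 10 + k ≠ 1 := by omega
    simp [abstain, Writes, WF, Expr.Storable, ih, this, h1]

/-- Array `1` stores multiplicities rather than flags: a voter chosen by several nested loops is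
counted several times, and each decrement restores the previous state exactly. Register `0` is only
ever raised, so it accumulates the disjunction over all trials. -/
theorem abstain_sem (w : List ℕ) (k : ℕ) (s : Store) :
    (abstain k).sem w s 1 = s 1 ∧ ((abstain k).sem w s 0 0 ≠ 0 ↔ s 0 0 ≠ 0 ∨
      ∃ A ⊆ Finset.range (w.getD 0 0), A.card ≤ k ∧
        greedyCost w ({x | s 1 x ≠ 0} ∪ A) (w.getD 0 0) ≤ w.getD 1 0) := by
  induction k generalizing s with
  | zero =>
    refine ⟨sem_of_not_writes w
      (by simp [abstain, evaluate, total, voter, payment, closure, checkMinimal, Writes]) s, ?_⟩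
    rw [abstain, evaluate_sem]
    refine or_congr Iff.rfl ⟨fun h => ⟨∅, by simp, by simp, by simpa using h⟩, ?_⟩
    rintro ⟨A, -, hA, h⟩
    obtain rfl := Finset.card_eq_zero.1 (Nat.le_zero.1 hA)
    simpa using h
  | succ k ih =>
    have hfirst := ih s
    have hloop := forN_induction (w := w) (c := 10 + k)
      (p := (.seq (.set 1 (reg (10 + k)) (.add (.get 1 (reg (10 + k))) (.const 1)))
        (.seq (abstain k)
          (.set 1 (reg (10 + k)) (.sub (.get 1 (reg (10 + k))) (.const 1))))))
      (s := (abstain k).sem w s)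
      -- After `m` rounds, the sets tried are those of size at most `k`, from the call before the
      -- loop, and those of size at most `k + 1` that contain some `x < m`.
      (fun m t => t 1 = s 1 ∧ (t 0 0 ≠ 0 ↔ s 0 0 ≠ 0 ∨
        ∃ A ⊆ Finset.range (w.getD 0 0), (A.card ≤ k ∨ ∃ x < m, x ∈ A ∧ A.card ≤ k + 1) ∧
          greedyCost w ({x | s 1 x ≠ 0} ∪ A) (w.getD 0 0) ≤ w.getD 1 0)) ?_ ?_
    · refine ⟨hloop.1, hloop.2.trans (or_congr Iff.rfl (exists_congr fun A => ?_))⟩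
      refine and_congr_right fun hA => and_congr_left fun _ => ?_
      constructor
      · rintro (h | ⟨_, _, _, h⟩) <;> omega
      · intro h
        rcases Nat.eq_zero_or_pos A.card with h0 | h0
        · exact Or.inl (by omega)
        · obtain ⟨x, hx⟩ := Finset.card_pos.1 h0
          exact Or.inr ⟨x, Finset.mem_range.1 (hA hx), hx, h⟩
    · rw [Store.write_of_ne _ _ _ (by omega), Store.write_of_ne _ _ _ (by omega)]
      simpa using hfirst
    · rintro m hm t ht ⟨h1, h0⟩
      rw [Store.write_of_ne _ _ _ (by omega), Store.write_of_ne _ _ _ (by omega)]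
      simp only [sem, Expr.eval, ht]
      set u := t.write 1 m (t 1 m + 1) with hu
      have hu1 : ∀ x, u 1 x = if x = m then s 1 m + 1 else s 1 x := by
        intro x
        rw [hu, Store.write_apply, h1]
        simp
      have hu0 : u 0 = t 0 := Store.write_of_ne _ _ _ (by decide)
      obtain ⟨i1, i0⟩ := ih u
      have hcount : (abstain k).sem w u (10 + k) 0 = m := by
        rw [sem_of_not_writes w (not_writes_abstain k _ le_rfl), hu,
          Store.write_of_ne _ _ _ (by omega), ht]
      rw [hcount]
      constructor
      · funext x
        rw [Store.write_apply, i1]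
        simp only [true_and, hu1]
        split_ifs with h <;> simp [h]
      · rw [Store.write_of_ne _ _ _ (by decide), i0, hu0, h0]
        have hset : ∀ A : Finset ℕ, {x | u 1 x ≠ 0} ∪ (A : Set ℕ)
            = {x | s 1 x ≠ 0} ∪ ((insert m A : Finset ℕ) : Set ℕ) := by
          intro A
          ext x
          by_cases hx : x = m <;> simp [hu1, hx]
        simp only [hset]
        constructor
        · rintro ((h | ⟨A, hA, hc, hg⟩) | ⟨A, hA, hc, hg⟩)
          · exact Or.inl h
          · refine Or.inr ⟨A, hA, hc.imp_right ?_, hg⟩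
            rintro ⟨x, hx, h⟩
            exact ⟨x, by omega, h⟩
          · exact Or.inr ⟨insert m A, Finset.insert_subset (Finset.mem_range.2 hm) hA,
              Or.inr ⟨m, by omega, Finset.mem_insert_self _ _,
                (Finset.card_insert_le _ _).trans (by omega)⟩, hg⟩
        · rintro (h | ⟨A, hA, hc | ⟨x, hx, hxA, hc⟩, hg⟩)
          · exact Or.inl (Or.inl h)
          · exact Or.inl (Or.inr ⟨A, hA, Or.inl hc, hg⟩)
          · rcases Nat.lt_succ_iff_lt_or_eq.1 hx with hx | rfl
            · exact Or.inl (Or.inr ⟨A, hA, Or.inr ⟨x, hx, hxA, hc⟩, hg⟩)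
            · refine Or.inr ⟨A.erase x, (Finset.erase_subset _ _).trans hA, ?_, ?_⟩
              · rw [Finset.card_erase_of_mem hxA]
                omega
              · rwa [Finset.insert_erase hxA]

end Prog

end RAM

/-! ### Translation between instances and their encodings. -/

namespace DRInstance

open RAM

variable (I : DRInstance)

theorem encode_zero : I.encode.getD 0 0 = I.n := rfl

theorem encode_one : I.encode.getD 1 0 = I.budget := rfl

theorem votingCost_encode (i : Fin I.n) : votingCost I.encode i = I.election.v i := by
  rw [votingCost, encode, add_comm 2]
  simp only [List.getD_cons_succ]
  rw [List.getD_append _ _ _ _ (by simp; omega), List.getD_append _ _ _ _ (by simp)]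
  simp

theorem delegatingCost_encode (i : Fin I.n) : delegatingCost I.encode i = I.election.d i := by
  rw [delegatingCost, encode_zero, encode, show 2 + I.n + i = I.n + (i : ℕ) + 2 by ring]
  simp only [List.getD_cons_succ]
  rw [List.getD_append _ _ _ _ (by simp), List.getD_append_right _ _ _ _ (by simp)]
  simp

/-- The matrix follows two numbers and two lists of length `n`. As `j < n`, the position `i * n + j`
has quotient `i` and remainder `j` modulo `n`. -/
theorem edge_encode (Z : Set ℕ) (i j : Fin I.n) :
    Edge I.encode Z i j ↔ I.election.graph.Adj i j ∧ (i : ℕ) ∉ Z ∧ (j : ℕ) ∉ Z := by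
  have hlt : (i : ℕ) * I.n + j < I.n * I.n := by
    have := Nat.mul_le_mul_right I.n (Nat.succ_le_of_lt i.2)
    rw [Nat.succ_mul] at this
    omega
  have hdiv : (⟨(i : ℕ) * I.n + j, hlt⟩ : Fin (I.n * I.n)).divNat = i := by
    ext
    simp only [Fin.coe_divNat]
    rw [mul_comm, Nat.mul_add_div i.pos, Nat.div_eq_of_lt j.2, add_zero]
  have hmod : (⟨(i : ℕ) * I.n + j, hlt⟩ : Fin (I.n * I.n)).modNat = j := by
    ext
    simp only [Fin.coe_modNat]
    rw [mul_comm, Nat.mul_add_mod, Nat.mod_eq_of_lt j.2]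
  rw [Edge, encode_zero, encode,
    show 2 + I.n + I.n + ((i : ℕ) * I.n + j) = I.n + I.n + ((i : ℕ) * I.n + j) + 2 by ring]
  simp only [List.getD_cons_succ]
  rw [List.getD_append_right _ _ _ _ (by simp),
    List.getD_eq_getElem _ _ (by simpa using hlt)]
  simp [hdiv, hmod]

/-- Although `n` is written in binary, the word has at least `n` entries, so loops of length `n` are
affordable. -/
theorem n_le_inputSize : I.encode.getD 0 0 ≤ inputSize I.encode := by
  refine le_trans ?_ (length_le_inputSize _)
  rw [encode_zero]
  simp [encode]
  omega

/-- Reachability in the remaining election, in terms of the encoded election. -/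
theorem reflTransGen_exclude_iff (A : Finset (Fin I.n)) (i j : {i // i ∉ A}) :
    Relation.ReflTransGen (I.election.exclude A).graph.Adj i j ↔
      Relation.ReflTransGen (Edge I.encode (A.map Fin.valEmbedding : Finset ℕ)) i.1 j.1 := by
  have hmem : ∀ i : Fin I.n, (i : ℕ) ∈ ((A.map Fin.valEmbedding : Finset ℕ) : Set ℕ) ↔ i ∈ A := by
    intro i
    rw [Finset.mem_coe]
    exact Finset.mem_map' Fin.valEmbedding
  constructor
  · intro h
    refine h.lift (fun i => (i.1 : ℕ)) fun a b hab => ?_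
    rw [Function.onFun, edge_encode, hmem, hmem]
    exact ⟨hab, a.2, b.2⟩
  · intro h
    generalize hx : (j.1 : ℕ) = x at h
    induction h generalizing j with
    | refl =>
      rw [Subtype.ext (Fin.ext hx)]
    | @tail b c _ hbc ih =>
      subst hx
      -- The edge relation itself keeps the predecessor in range and outside `A`, so the path lifts
      -- back to the remaining election.
      have hb : b < I.n := hbc.1.1
      lift b to Fin I.n using hb
      rw [edge_encode, hmem, hmem] at hbc
      exact (ih ⟨b, hbc.2.1⟩ rfl).tail hbc.1

/-- The greedy criterion is applied to the remaining election with the original index as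
tie-breaker, which is what the program compares. -/
theorem delegateReachability_exclude_iff (A : Finset (Fin I.n)) :
    (I.election.exclude A).DelegateReachability I.budget ↔
      greedyCost I.encode (A.map Fin.valEmbedding : Finset ℕ) I.n ≤ I.budget := by
  classical
  have hmem : ∀ i : Fin I.n, (i : ℕ) ∈ ((A.map Fin.valEmbedding : Finset ℕ) : Set ℕ) ↔ i ∈ A := by
    intro i
    rw [Finset.mem_coe]
    exact Finset.mem_map' Fin.valEmbedding
  rw [CLDElection.delegateReachability_iff (I.election.exclude A) (fun i => (i.1 : ℕ))
    (Fin.val_injective.comp Subtype.val_injective)]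
  have hcast : ∀ i : {i // i ∉ A}, (I.election.exclude A).GreedyCast (fun i => (i.1 : ℕ)) i ↔
      WordCast I.encode (A.map Fin.valEmbedding : Finset ℕ) i.1 := by
    intro i
    rw [CLDElection.GreedyCast, WordCast, votingCost_encode, delegatingCost_encode]
    refine or_congr Iff.rfl ⟨fun h j hj hij => ?_, fun h j hij => ?_⟩
    · rw [encode_zero] at hj
      lift j to Fin I.n using hj
      -- A vertex reached from `i` is `i` itself or the end of an edge, and edges avoid `A`.
      have hjA : j ∉ A := by
        rcases Relation.ReflTransGen.cases_tail hij with h | ⟨b, -, hb⟩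
        · rw [Fin.ext h]
          exact i.2
        · exact fun hj => hb.2.2.2 ((hmem j).2 hj)
      rw [votingCost_encode, delegatingCost_encode]
      have := h ⟨j, hjA⟩ ((I.reflTransGen_exclude_iff A i ⟨j, hjA⟩).2 hij)
      rwa [reflTransGen_exclude_iff] at this
    · have := h j.1 j.1.2 ((I.reflTransGen_exclude_iff A i j).1 hij)
      rw [votingCost_encode, delegatingCost_encode] at this
      rwa [reflTransGen_exclude_iff]
  refine iff_of_eq (congrArg (· ≤ I.budget) ?_)
  -- The sum over the remaining voters is the sum over all voters with zero for the excluded ones.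
  have hsub := Finset.sum_subtype (Finset.univ.filter fun i => i ∉ A) (p := fun i => i ∉ A)
    (F := inferInstance)
    (by simp) fun i : Fin I.n =>
      if WordCast I.encode (A.map Fin.valEmbedding : Finset ℕ) i
        then I.election.v i else I.election.d i
  rw [Finset.sum_filter] at hsub
  rw [greedyCost, Finset.sum_range]
  simp only [hcast, hmem, votingCost_encode, delegatingCost_encode]
  simp only [ite_not] at hsub
  exact hsub.symm

end DRInstance

theorem mainTheorem11 (α : ℕ) :
    RAM.PolyTimeDecidable DRInstance.encode
      (fun I : DRInstance => I.election.DelegateReachabilityWithAbstainers α I.budget) := by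
  refine .of_prog (RAM.Prog.wf_abstain α) DRInstance.n_le_inputSize fun I => ?_
  rw [(RAM.Prog.abstain_sem I.encode α _).2, I.encode_zero, I.encode_one]
  -- The memory is initially zero, so at the start no voter is excluded and the answer is negative.
  simp only [ne_eq, not_true_eq_false, false_or, Set.ofPred_false, Set.empty_union]
  constructor
  · rintro ⟨A, hA, hc, hg⟩
    have hmap : (A.attachFin fun x hx => Finset.mem_range.1 (hA hx)).map Fin.valEmbedding = A :=
      Finset.map_valEmbedding_attachFin fun x hx => Finset.mem_range.1 (hA hx)
    refine ⟨A.attachFin fun x hx => Finset.mem_range.1 (hA hx), by simpa using hc, ?_⟩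
    rwa [I.delegateReachability_exclude_iff, hmap]
  · rintro ⟨A, hc, h⟩
    refine ⟨A.map Fin.valEmbedding, fun x hx => ?_, by simpa using hc,
      (I.delegateReachability_exclude_iff A).1 h⟩
    obtain ⟨i, -, rfl⟩ := Finset.mem_map.1 hx
    exact Finset.mem_range.2 i.2
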